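/- Let $R$ be a commutative ring and $q\in R$ an invertible element (for instance $q$ an indeterminate, $R=\mathbb C[q,q^{-1}]$). Let $\mathbf{Sym}$ be the algebra of noncommutative symmetric functions over $R$, i.e. the free associative $R$-algebra on the complete functions $S_1,S_2,\dots$ with $\deg S_n=n$, and $S_0=1$; let $R_I$ denote the ribbon functions. Let $\mathrm{PF}_n$ be the set of parking functions of length $n$, i.e. of the words $a_1\cdots a_n$ over $\{1,\dots,n\}$ whose nondecreasing rearrangement $a'_1\cdots a'_n$ satisfies $a'_i\le i$ for all $i$, and put $\|a\|=\sum_i(a_i-1)$. The $0$-Hecke algebra $H_n(0)$ is the $\mathbb C$-algebra generated by $T_1,\dots,T_{n-1}$ subject to the braid relations and $T_i(T_i+1)=0$. It acts on the right on $\mathbb C\,\mathrm{PF}_n$ by: $w\cdot T_i$ is $w$ with its $i$-th and $(i+1)$-st letters exchanged if $w_i<w_{i+1}$; $w\cdot T_i=0$ if $w_i=w_{i+1}$; $w\cdot T_i=-w$ if $w_i>w_{i+1}$. For a finite-dimensional projective right $H_n(0)$-module $M$, its noncommutative Frobenius characteristic is $\mathbf{ch}(M)=\sum_{I\vDash n}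 m_I(M)\,R_I$, where $m_I(M)=\dim\mathrm{Hom}_{H_n(0)}(M,C_I)$ is the multiplicity in $M$ of the projective cover of the simple module $C_I$, on which $T_i$ acts by $-1$ if $i$ is a descent of the composition $I$ and by $0$ otherwise. Put $\mathbf{ch}_q(\mathrm{PF}_n)=\sum_k q^k\,\mathbf{ch}(M_{n,k})$, where $M_{n,k}\subset\mathbb C\,\mathrm{PF}_n$ is the submodule spanned by the $a\in\mathrm{PF}_n$ with $\|a\|=k$, and write $\mathbf{ch}(\mathrm{PF}_n)$ for $\mathbf{ch}(\mathbb C\,\mathrm{PF}_n)$. Finally, with $x$ a central variable, let $$G(x,q;A)=\sum_{n\ge0}x^nq^{-\binom{n+1}2}\,\mathbf{ch}_q(\mathrm{PF}_n)\in\mathbf{Sym}[[x]].$$ **Theorem.** (1) The series $K(x)=xq\,G(x,q^{-1};A)$ satisfies the noncommutative $q$-Lagrange functional equation $$K(x)=qx\sum_{n\ge0}S_n\,K^{(n)}(x),\qquad K^{(n)}(x)=K(q^{n-1}x)K(q^{n-2}x)\cdots K(x)\quad(K^{(0)}=1),$$ the sum being convergent in $\mathbf{Sym}[[x]]$ for the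 $x$-adic topology. (2) For $q=1$, the coefficient of $x^n$ in $G(x,1;A)$ is $\mathbf{ch}(\mathrm{PF}_n)$ for every $n\geq 0$, and $g=G(1,1;A)=\sum_{n\ge0}\mathbf{ch}(\mathrm{PF}_n)$, an element of the completion $\prod_{n\ge0}\mathbf{Sym}_n$ of $\mathbf{Sym}$ for the degree, is the unique solution in this completion of $$g=\sum_{n\ge0}S_n\,g^n .$$ -/

import Mathlib

open scoped PowerSeries

noncomputable section

namespace NCLagrange

/-! ## The 0-Hecke algebra -/

/-- The left one of the two adjacent positions exchanged by the `i`-th generator. -/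
def lo {n : ℕ} (i : Fin (n - 1)) : Fin n := ⟨i, by omega⟩

/-- The right one of the two adjacent positions exchanged by the `i`-th generator. -/
def hi {n : ℕ} (i : Fin (n - 1)) : Fin n := ⟨i + 1, by omega⟩

/-- Defining relations of `H_n(0)`: the braid relations and `T_i (T_i + 1) = 0`. -/
inductive HeckeRel (n : ℕ) :
    FreeAlgebra ℂ (Fin (n - 1)) → FreeAlgebra ℂ (Fin (n - 1)) → Prop
  | quad (i : Fin (n - 1)) :
      HeckeRel n (FreeAlgebra.ι ℂ i * (FreeAlgebra.ι ℂ i + 1)) 0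
  | braid (i j : Fin (n - 1)) (h : (i : ℕ) + 1 = j) :
      HeckeRel n (FreeAlgebra.ι ℂ i * FreeAlgebra.ι ℂ j * FreeAlgebra.ι ℂ i)
        (FreeAlgebra.ι ℂ j * FreeAlgebra.ι ℂ i * FreeAlgebra.ι ℂ j)
  | comm (i j : Fin (n - 1)) (h : (i : ℕ) + 1 < j) :
      HeckeRel n (FreeAlgebra.ι ℂ i * FreeAlgebra.ι ℂ j)
        (FreeAlgebra.ι ℂ j * FreeAlgebra.ι ℂ i)

/-- The 0-Hecke algebra `H_n(0)` over `ℂ`. -/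
abbrev Hecke (n : ℕ) : Type := RingQuot (HeckeRel n)

/-- The generator `T_i` of `H_n(0)`, exchanging the positions `i` and `i + 1` (counted from 0). -/
def Hecke.T {n : ℕ} (i : Fin (n - 1)) : Hecke n :=
  RingQuot.mkAlgHom ℂ (HeckeRel n) (FreeAlgebra.ι ℂ i)

/-- The universal property of `H_n(0)`. -/
def Hecke.lift {n : ℕ} {B : Type*} [Semiring B] [Algebra ℂ B] (t : Fin (n - 1) → B)
    (hquad : ∀ i, t i * (t i + 1) = 0)
    (hbraid : ∀ i j : Fin (n - 1), (i : ℕ) + 1 = j → t i * t j * t i = t j * t i * t j)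
    (hcomm : ∀ i j : Fin (n - 1), (i : ℕ) + 1 < j → t i * t j = t j * t i) :
    Hecke n →ₐ[ℂ] B :=
  RingQuot.liftAlgHom ℂ ⟨FreeAlgebra.lift ℂ t, by
    intro x y h
    cases h with
    | quad i => simpa using hquad i
    | braid i j h => simpa using hbraid i j h
    | comm i j h => simpa using hcomm i j h⟩

theorem Hecke.lift_T {n : ℕ} {B : Type*} [Semiring B] [Algebra ℂ B] (t : Fin (n - 1) → B)
    (hquad : ∀ i, t i * (t i + 1) = 0)
    (hbraid : ∀ i j : Fin (n - 1), (i : ℕ) + 1 = j → t i * t j * t i = t j * t i * t j)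
    (hcomm : ∀ i j : Fin (n - 1), (i : ℕ) + 1 < j → t i * t j = t j * t i)
    (i : Fin (n - 1)) : Hecke.lift t hquad hbraid hcomm (Hecke.T i) = t i := by
  simp [Hecke.lift, Hecke.T]

/-- The value of the generator `T_i` on the one-dimensional simple module attached to the
composition `I` of `n`: it is `-1` if `i + 1` is a descent of `I` (a partial sum of its parts,
different from `0` and `n`), and `0` otherwise. -/
def simpleVal {n : ℕ} (I : Composition n) (i : Fin (n - 1)) : ℂ :=
  if (hi i).castSucc ∈ I.boundaries then -1 else 0

/-- The character of the one-dimensional simple `H_n(0)`-module `C_I`. -/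
def simpleChar {n : ℕ} (I : Composition n) : Hecke n →ₐ[ℂ] ℂ :=
  Hecke.lift (simpleVal I)
    (by intro i; unfold simpleVal; split_ifs <;> simp)
    (by intro i j _; unfold simpleVal; split_ifs <;> simp)
    (by intro i j _; ring)

/-- A right `H_n(0)`-module structure on a complex vector space `M`; the element `m · h` is
`(ρ h).unop m`. -/
abbrev RightRep (n : ℕ) (M : Type*) [AddCommGroup M] [Module ℂ M] : Type _ :=
  Hecke n →ₐ[ℂ] (Module.End ℂ M)ᵐᵒᵖ

/-- The space `Hom(M, C_I)` of homomorphisms of right `H_n(0)`-modules. -/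
def homToSimple {n : ℕ} {M : Type*} [AddCommGroup M] [Module ℂ M] (ρ : RightRep n M)
    (I : Composition n) : Submodule ℂ (Module.Dual ℂ M) where
  carrier := {f | ∀ (h : Hecke n) (m : M), f ((ρ h).unop m) = simpleChar I h * f m}
  add_mem' := by
    intro f g hf hg h m
    simp only [LinearMap.add_apply, hf h m, hg h m]; ring
  zero_mem' := by intro h m; simp
  smul_mem' := by
    intro c f hf h m
    simp only [LinearMap.smul_apply, hf h m, smul_eq_mul]; ring

/-! ## Noncommutative symmetric functions -/

/-- The algebra of noncommutative symmetric functions over `R`: the free associative algebra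
on the complete functions `S_1, S_2, …`. -/
abbrev NSym (R : Type*) [CommRing R] : Type _ := FreeAlgebra R ℕ+

/-- The complete function `S_n`, with `S_0 = 1`. -/
def S (R : Type*) [CommRing R] (n : ℕ) : NSym R :=
  if h : 0 < n then FreeAlgebra.ι R ⟨n, h⟩ else 1

/-- `S^I = S_{i_1} ⋯ S_{i_r}`. -/
def SComp (R : Type*) [CommRing R] {n : ℕ} (I : Composition n) : NSym R :=
  (I.blocks.map (S R)).prod

/-- The ribbon function `R_I = ∑_J (-1)^{ℓ(I) - ℓ(J)} S^J`, the sum being over all compositions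
`J` of `n` that are coarser than or equal to `I`. -/
def ribbon (R : Type*) [CommRing R] {n : ℕ} (I : Composition n) : NSym R :=
  ∑ J : Composition n with J.boundaries ⊆ I.boundaries,
    (-1 : R) ^ (I.length - J.length) • SComp R J

/-- The homogeneous component of degree `n`, spanned by the `S^I`, `I` a composition of `n`. -/
def homog (R : Type*) [CommRing R] (n : ℕ) : Submodule R (NSym R) :=
  Submodule.span R (Set.range fun I : Composition n => SComp R I)

/-- The noncommutative Frobenius characteristic of a finite-dimensional projective right
`H_n(0)`-module `M`: the sum of the ribbons `R_I`, each taken as many times as the indecomposable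
projective module `P_I` (the projective cover of `C_I`) occurs in `M` as a direct summand. Since
`Hom(P_J, C_I)` is one-dimensional for `I = J` and zero otherwise, this multiplicity is
the dimension of `Hom(M, C_I)`. -/
def ch (R : Type*) [CommRing R] {n : ℕ} {M : Type*} [AddCommGroup M] [Module ℂ M]
    (ρ : RightRep n M) : NSym R :=
  ∑ I : Composition n, (Module.finrank ℂ (homToSimple ρ I)) • ribbon R I

/-! ## Permutational modules -/

/-- Words of length `n` in the ordered alphabet of natural numbers. -/
abbrev Word (n : ℕ) : Type := Fin n → ℕ

/-- A finite set of words is stable if it contains all the rearrangements of its elements. -/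
def Stable {n : ℕ} (W : Finset (Word n)) : Prop :=
  ∀ w ∈ W, ∀ σ : Equiv.Perm (Fin n), w ∘ σ ∈ W

/-- Exchange of the letters in the positions `i` and `i + 1`. -/
def swapWord {n : ℕ} {W : Finset (Word n)} (hW : Stable W) (i : Fin (n - 1)) (w : W) : W :=
  ⟨w.1 ∘ Equiv.swap (lo i) (hi i), hW w.1 w.2 _⟩

/-- The image `w · T_i` of a word. -/
def wordT {n : ℕ} {W : Finset (Word n)} (hW : Stable W) (i : Fin (n - 1)) (w : W) : W →₀ ℂ :=
  if w.1 (lo i) < w.1 (hi i) then Finsupp.single (swapWord hW i w) 1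
  else if w.1 (lo i) = w.1 (hi i) then 0
  else -Finsupp.single w 1

/-- The operator `T_i` on the vector space with basis `W`. -/
def opT {n : ℕ} {W : Finset (Word n)} (hW : Stable W) (i : Fin (n - 1)) :
    Module.End ℂ (W →₀ ℂ) :=
  Finsupp.linearCombination ℂ (wordT hW i)

theorem opT_single {n : ℕ} {W : Finset (Word n)} (hW : Stable W) (i : Fin (n - 1)) (w : W) :
    opT hW i (Finsupp.single w 1) = wordT hW i w := by
  simp [opT]

theorem opT_lt {n : ℕ} {W : Finset (Word n)} (hW : Stable W) (i : Fin (n - 1)) (w : W)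
    (h : w.1 (lo i) < w.1 (hi i)) :
    opT hW i (Finsupp.single w 1) = Finsupp.single (swapWord hW i w) 1 := by
  simp [opT_single, wordT, h]

theorem opT_eq {n : ℕ} {W : Finset (Word n)} (hW : Stable W) (i : Fin (n - 1)) (w : W)
    (h : w.1 (lo i) = w.1 (hi i)) :
    opT hW i (Finsupp.single w 1) = 0 := by
  simp [opT_single, wordT, h]

theorem opT_gt {n : ℕ} {W : Finset (Word n)} (hW : Stable W) (i : Fin (n - 1)) (w : W)
    (h : w.1 (hi i) < w.1 (lo i)) :
    opT hW i (Finsupp.single w 1) = -Finsupp.single w 1 := by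
  simp [opT_single, wordT, h.not_gt, h.ne']

theorem swapWord_lo {n : ℕ} {W : Finset (Word n)} (hW : Stable W) (i : Fin (n - 1)) (w : W) :
    (swapWord hW i w).1 (lo i) = w.1 (hi i) := by
  simp [swapWord]

theorem swapWord_hi {n : ℕ} {W : Finset (Word n)} (hW : Stable W) (i : Fin (n - 1)) (w : W) :
    (swapWord hW i w).1 (hi i) = w.1 (lo i) := by
  simp [swapWord]

theorem swapWord_of_ne {n : ℕ} {W : Finset (Word n)} (hW : Stable W) (i : Fin (n - 1)) (w : W)
    (k : Fin n) (h₁ : k ≠ lo i) (h₂ : k ≠ hi i) :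
    (swapWord hW i w).1 k = w.1 k := by
  simp [swapWord, Equiv.swap_apply_of_ne_of_ne h₁ h₂]

theorem opT_quad {n : ℕ} {W : Finset (Word n)} (hW : Stable W) (i : Fin (n - 1)) :
    (opT hW i + 1) * opT hW i = 0 := by
  ext1 w
  ext1
  simp only [LinearMap.comp_apply, Finsupp.lsingle_apply, Module.End.mul_apply,
    LinearMap.zero_apply, LinearMap.add_apply, Module.End.one_apply]
  rcases lt_trichotomy (w.1 (lo i)) (w.1 (hi i)) with h | h | h
  · rw [opT_lt hW i w h, opT_gt hW i (swapWord hW i w) (by rwa [swapWord_lo, swapWord_hi])]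
    simp
  · rw [opT_eq hW i w h]; simp
  · rw [opT_gt hW i w h, map_neg, opT_gt hW i w h]; simp

theorem opT_comm {n : ℕ} {W : Finset (Word n)} (hW : Stable W) (i j : Fin (n - 1))
    (hij : (i : ℕ) + 1 < j) : opT hW j * opT hW i = opT hW i * opT hW j := by
  have e1 : lo i ≠ lo j := by simp [lo, Fin.ext_iff]; omega
  have e2 : lo i ≠ hi j := by simp [lo, hi, Fin.ext_iff]; omega
  have e3 : hi i ≠ lo j := by simp [lo, hi, Fin.ext_iff]; omega
  have e4 : hi i ≠ hi j := by simp [hi, Fin.ext_iff]; omega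
  have a1 (w : W) : (swapWord hW i w).1 (lo j) = w.1 (lo j) :=
    swapWord_of_ne hW i w _ e1.symm e3.symm
  have a2 (w : W) : (swapWord hW i w).1 (hi j) = w.1 (hi j) :=
    swapWord_of_ne hW i w _ e2.symm e4.symm
  have a3 (w : W) : (swapWord hW j w).1 (lo i) = w.1 (lo i) := swapWord_of_ne hW j w _ e1 e2
  have a4 (w : W) : (swapWord hW j w).1 (hi i) = w.1 (hi i) := swapWord_of_ne hW j w _ e3 e4
  ext1 w
  ext1
  have hs : swapWord hW j (swapWord hW i w) = swapWord hW i (swapWord hW j w) := by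
    apply Subtype.ext
    funext k
    by_cases k1 : k = lo i
    · subst k1; rw [swapWord_lo, swapWord_of_ne hW j _ _ e1 e2, swapWord_lo, a4]
    by_cases k2 : k = hi i
    · subst k2; rw [swapWord_hi, swapWord_of_ne hW j _ _ e3 e4, swapWord_hi, a3]
    by_cases k3 : k = lo j
    · subst k3; rw [swapWord_lo, swapWord_of_ne hW i _ _ k1 k2, swapWord_lo, a2]
    by_cases k4 : k = hi j
    · subst k4; rw [swapWord_hi, swapWord_of_ne hW i _ _ k1 k2, swapWord_hi, a1]
    rw [swapWord_of_ne hW j _ _ k3 k4, swapWord_of_ne hW i _ _ k1 k2,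
      swapWord_of_ne hW i _ _ k1 k2, swapWord_of_ne hW j _ _ k3 k4]
  simp only [LinearMap.comp_apply, Finsupp.lsingle_apply, Module.End.mul_apply]
  rcases lt_trichotomy (w.1 (lo i)) (w.1 (hi i)) with h | h | h <;>
  rcases lt_trichotomy (w.1 (lo j)) (w.1 (hi j)) with h' | h' | h' <;>
  simp [opT_lt, opT_eq, opT_gt, h, h', a1, a2, a3, a4, hs]

theorem opT_braid {n : ℕ} {W : Finset (Word n)} (hW : Stable W) (i j : Fin (n - 1))
    (hij : (i : ℕ) + 1 = j) :
    opT hW i * opT hW j * opT hW i = opT hW j * opT hW i * opT hW j := by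
  have e0 : lo j = hi i := by simp [lo, hi, Fin.ext_iff]; omega
  have e2 : lo i ≠ hi j := by simp [lo, hi, Fin.ext_iff]; omega
  have e5 : lo i ≠ hi i := by simp [lo, hi, Fin.ext_iff]
  have e4 : hi i ≠ hi j := by simp [hi, Fin.ext_iff]; omega
  have a1 (w : W) : (swapWord hW i w).1 (hi j) = w.1 (hi j) :=
    swapWord_of_ne hW i w _ e2.symm e4.symm
  have a2 (w : W) : (swapWord hW j w).1 (lo i) = w.1 (lo i) :=
    swapWord_of_ne hW j w _ (by rw [e0]; exact e5) e2
  have a3 (w : W) : (swapWord hW j w).1 (hi i) = w.1 (hi j) := by rw [← e0, swapWord_lo]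
  have a4 (w : W) : (swapWord hW j w).1 (hi j) = w.1 (hi i) := by rw [swapWord_hi, e0]
  have hs (w : W) : swapWord hW i (swapWord hW j (swapWord hW i w)) =
      swapWord hW j (swapWord hW i (swapWord hW j w)) := by
    apply Subtype.ext
    funext k
    by_cases k1 : k = lo i
    · subst k1; simp only [swapWord_lo, a1, a2, a3]
    by_cases k2 : k = hi i
    · subst k2; simp only [swapWord_lo, swapWord_hi, a1, a2, a3, a4]
    by_cases k3 : k = hi j
    · subst k3; simp only [swapWord_hi, a1, a2, a4]
    have k4 : k ≠ lo j := by rwa [e0]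
    simp only [swapWord_of_ne hW i _ _ k1 k2, swapWord_of_ne hW j _ _ k4 k3]
  ext1 w
  ext1
  simp only [LinearMap.comp_apply, Finsupp.lsingle_apply, Module.End.mul_apply]
  rcases lt_trichotomy (w.1 (lo i)) (w.1 (hi i)) with h | h | h <;>
  rcases lt_trichotomy (w.1 (hi i)) (w.1 (hi j)) with h' | h' | h' <;>
  rcases lt_trichotomy (w.1 (lo i)) (w.1 (hi j)) with h'' | h'' | h'' <;>
  first
  | omega
  | simp [opT_lt, opT_eq, opT_gt, h, h', h'', a1, a2, a3, a4, hs, swapWord_lo, swapWord_hi, e0]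

/-- The permutational right `H_n(0)`-module with basis a stable finite set `W` of words. -/
def permRep {n : ℕ} {W : Finset (Word n)} (hW : Stable W) : RightRep n (W →₀ ℂ) :=
  Hecke.lift (fun i => MulOpposite.op (opT hW i))
    (fun i => by
      apply MulOpposite.unop_injective
      simpa using opT_quad hW i)
    (fun i j h => by
      apply MulOpposite.unop_injective
      simpa [mul_assoc] using opT_braid hW i j h)
    (fun i j h => by
      apply MulOpposite.unop_injective
      simpa using opT_comm hW i j h)

/-- The normalized sum of letters `‖w‖ = ∑ (a_i - 1)`, for words with positive letters. -/
def weight {n : ℕ} (w : Word n) : ℕ := ∑ i, (w i - 1)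

theorem Stable.filter_weight {n : ℕ} {W : Finset (Word n)} (hW : Stable W) (k : ℕ) :
    Stable {w ∈ W | weight w = k} := by
  intro w hw σ
  rw [Finset.mem_filter] at hw ⊢
  refine ⟨hW w hw.1 σ, ?_⟩
  rw [← hw.2]
  exact Equiv.sum_comp σ fun i => w i - 1

/-- The `q`-characteristic `∑_k q^k ch(M_k)` of the permutational module on `W`, where `M_k` is
spanned by the words of `W` with `‖w‖ = k`. -/
def chq {R : Type*} [CommRing R] (q : R) {n : ℕ} {W : Finset (Word n)} (hW : Stable W) :
    NSym R :=
  ∑ k ∈ W.image weight, q ^ k • ch R (permRep (hW.filter_weight k))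

/-! ## Parking functions -/

/-- The set `PF_n` of parking functions: the words `a` on `{1, …, n}` whose nondecreasing
rearrangement `a'` satisfies `a'_i ≤ i` for all `i` (positions are counted from 0 below). -/
def PF (n : ℕ) : Finset (Word n) :=
  {a ∈ Fintype.piFinset fun _ : Fin n => Finset.Icc 1 n |
    ∀ i : Fin n, a (Tuple.sort a i) ≤ (i : ℕ) + 1}

theorem PF_stable (n : ℕ) : Stable (PF n) := by
  intro w hw σ
  simp only [PF, Finset.mem_filter, Fintype.mem_piFinset] at hw ⊢
  refine ⟨fun i => hw.1 (σ i), fun i => ?_⟩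
  have h := congrFun (Tuple.comp_perm_comp_sort_eq_comp_sort (f := w) (σ := σ)) i
  simp only [Function.comp_apply] at h ⊢
  rw [h]
  exact hw.2 i

/-! ## Formal series -/

/-- `∑_n f_n = a` for formal power series in `x`: every coefficient of the partial sums over
finite sets of indices is eventually constant, equal to the coefficient of `a`. -/
def FormalHasSum {A : Type*} [Semiring A] (f : ℕ → A⟦X⟧) (a : A⟦X⟧) : Prop :=
  ∀ N : ℕ, ∀ᶠ s : Finset ℕ in Filter.atTop,
    PowerSeries.coeff N (∑ n ∈ s, f n) = PowerSeries.coeff N a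

/-- `f(c x)`, where the scalar `c` and `x` are central. -/
def dilate {R : Type*} [CommRing R] (c : R) (f : (NSym R)⟦X⟧) : (NSym R)⟦X⟧ :=
  PowerSeries.mk fun m => c ^ m • PowerSeries.coeff m f

/-- `f^{(n)}(x) = f(q^{n-1} x) ⋯ f(q x) f(x)`. -/
def qPow {R : Type*} [CommRing R] (q : R) (f : (NSym R)⟦X⟧) : ℕ → (NSym R)⟦X⟧
  | 0 => 1
  | n + 1 => dilate (q ^ n) f * qPow q f n

/-- `G(x, q; A) = ∑_n x^n q^{-n(n+1)/2} ch_q(PF_n)`. -/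
def G {R : Type*} [CommRing R] (q : Rˣ) : (NSym R)⟦X⟧ :=
  PowerSeries.mk fun n =>
    ((q⁻¹ ^ (n + 1).choose 2 : Rˣ) : R) • chq (q : R) (PF_stable n)

/-- `K(x) = x q G(x, q⁻¹; A)`. -/
def K {R : Type*} [CommRing R] (q : Rˣ) : (NSym R)⟦X⟧ :=
  PowerSeries.X * ((q : R) • G q⁻¹)

/-! ## The completion of the algebra of noncommutative symmetric functions -/

theorem SComp_mem {R : Type*} [CommRing R] {n : ℕ} (I : Composition n) :
    SComp R I ∈ homog R n :=
  Submodule.subset_span ⟨I, rfl⟩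

theorem homog_mul_mem {R : Type*} [CommRing R] {m n : ℕ} {a b : NSym R}
    (ha : a ∈ homog R m) (hb : b ∈ homog R n) : a * b ∈ homog R (m + n) := by
  have h := Submodule.mul_mem_mul ha hb
  rw [homog, homog, Submodule.span_mul_span] at h
  refine Submodule.span_le.2 ?_ h
  rintro _ ⟨_, ⟨I, rfl⟩, _, ⟨J, rfl⟩, rfl⟩
  have e : SComp R I * SComp R J = SComp R (I.append J) := by
    simp [SComp, Composition.append]
  change SComp R I * SComp R J ∈ _
  rw [e]
  exact SComp_mem _

theorem algebraMap_mem_homog (R : Type*) [CommRing R] (r : R) :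
    algebraMap R (NSym R) r ∈ homog R 0 := by
  have h : (1 : NSym R) ∈ homog R 0 := by
    have := SComp_mem (R := R) (Composition.ones 0)
    simpa [SComp, Composition.ones] using this
  rw [Algebra.algebraMap_eq_smul_one]
  exact Submodule.smul_mem _ _ h

theorem S_mem (R : Type*) [CommRing R] (n : ℕ) : S R n ∈ homog R n := by
  by_cases h : 0 < n
  · have := SComp_mem (R := R) (Composition.single n h)
    simpa [SComp, Composition.single] using this
  · obtain rfl : n = 0 := by omega
    simpa [S] using algebraMap_mem_homog R 1

theorem ribbon_mem {R : Type*} [CommRing R] {n : ℕ} (I : Composition n) :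
    ribbon R I ∈ homog R n :=
  Submodule.sum_mem _ fun J _ => Submodule.smul_mem _ _ (SComp_mem J)

theorem ch_mem (R : Type*) [CommRing R] {n : ℕ} {M : Type*} [AddCommGroup M] [Module ℂ M]
    (ρ : RightRep n M) : ch R ρ ∈ homog R n :=
  Submodule.sum_mem _ fun I _ => nsmul_mem (ribbon_mem I) _

/-- The completion `∏_n Sym_n` of the graded algebra of noncommutative symmetric functions, that
is, the algebra of the infinite sums `∑_n f_n` with `f_n` homogeneous of degree `n`. Such a sum is
recorded as the series `∑_n f_n t^n`, in which `t` only marks the degree. -/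
def NSymHat (R : Type*) [CommRing R] : Subalgebra R (NSym R)⟦X⟧ where
  carrier := {f | ∀ n, PowerSeries.coeff n f ∈ homog R n}
  mul_mem' := by
    intro f g hf hg n
    rw [PowerSeries.coeff_mul]
    refine Submodule.sum_mem _ fun p hp => ?_
    rw [← Finset.HasAntidiagonal.mem_antidiagonal.1 hp]
    exact homog_mul_mem (hf _) (hg _)
  add_mem' := by
    intro f g hf hg n
    rw [map_add]
    exact Submodule.add_mem _ (hf n) (hg n)
  algebraMap_mem' := by
    intro r n
    rw [PowerSeries.algebraMap_apply, PowerSeries.coeff_C]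
    split_ifs with h
    · subst h; exact algebraMap_mem_homog R r
    · exact Submodule.zero_mem _

/-- The infinite sum `∑_n f_n` of homogeneous elements `f_n` of degree `n`. -/
def NSymHat.ofComponents {R : Type*} [CommRing R] (f : ∀ n, homog R n) : NSymHat R :=
  ⟨PowerSeries.mk fun n => (f n : NSym R), fun n => by
    rw [PowerSeries.coeff_mk]; exact (f n).2⟩

/-- An element of `Sym_n`, seen in the completion. -/
def NSymHat.ofHomog {R : Type*} [CommRing R] (n : ℕ) (a : homog R n) : NSymHat R :=
  ⟨PowerSeries.monomial n (a : NSym R), fun m => by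
    rw [PowerSeries.coeff_monomial]
    split_ifs with h
    · subst h; exact a.2
    · exact Submodule.zero_mem _⟩

/-- `∑_n f_n = a` in the completion, for the topology defined by the degree. -/
def NSymHat.HasSum {R : Type*} [CommRing R] (f : ℕ → NSymHat R) (a : NSymHat R) : Prop :=
  FormalHasSum (fun n => (f n : (NSym R)⟦X⟧)) (a : (NSym R)⟦X⟧)

/-- The equation `g = ∑_n S_n g^n` in the completion. -/
def LagrangeEq {R : Type*} [CommRing R] (g : NSymHat R) : Prop :=
  NSymHat.HasSum (fun n => NSymHat.ofHomog n ⟨S R n, S_mem R n⟩ * g ^ n) g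

/-- `g = ∑_n ch(PF_n)`. -/
def gPF (R : Type*) [CommRing R] : NSymHat R :=
  NSymHat.ofComponents fun n => ⟨ch R (permRep (PF_stable n)), ch_mem R _⟩

end NCLagrange

end

noncomputable section

namespace NCLagrange

/-! ## Compositions and their descent sets -/

/-! A homomorphism from the module on a stable set of words to `C_I` is a linear form that is
antisymmetric under exchanges at the descents of `I` and kills every word with a descent elsewhere.
Such a form is determined, freely, by its values on the nondecreasing words that increase strictly
at the descents of `I` (`finrank_homToSimple_permRep`). So a nondecreasing word contributes `R_I`
for every `I` whose descents are among its strict ascents, and Möbius inversion (`sum_ribbon`)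
collapses these ribbons into a single product of complete functions, indexed by the multiplicities
of the letters (`ch_permRep`, `ascentComp_eq_ofMult`).

For parking functions the multiplicities `m` are those whose partial sums stay above the diagonal.
After `q` is inverted and the power of `q` normalized, the weight becomes the area
(`pow_choose_smul_chq`). Hence the coefficients of `K` enumerate Łukasiewicz paths from height 1 to
height 0, where `S_k` records a step of height `k - 1` and each step starting at height `h` has
weight `q ^ h` (`coeff_K`).

Cutting a path from height `a + b` at its first visit to height `b` gives a path from `a`, raised by
`b`, followed by a path from `b` (`lukSum_add`). Raising by `b` multiplies the weight by `q ^ b` per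
step, which is the dilation `x ↦ q ^ b x`; so `K^{(n)}` enumerates the paths from height `n`
(`coeff_qPow_K`). Removing the first step of a path from height 1 is then the functional equation.

For `q = 1`, `K = x g`, and cancelling `x` gives the equation for `g`. It is triangular in the
degree, hence has only one solution. -/

/-- The bijection sending a composition of `n` to its descent set. -/
def descentEquiv (n : ℕ) : Composition n ≃ Finset (Fin (n - 1)) :=
  (compositionEquiv n).trans (compositionAsSetEquiv n)

theorem mem_descentEquiv {n : ℕ} (I : Composition n) (i : Fin (n - 1)) :
    i ∈ descentEquiv n I ↔ (hi i).castSucc ∈ I.boundaries := by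
  have : (⟨1 + (i : ℕ), by omega⟩ : Fin n.succ) = (hi i).castSucc := by
    ext; simp [hi, add_comm]
  rw [← this]
  exact Set.mem_toFinset

/-- The index may be unbounded: past the last block, the partial sum stays equal to `n`. -/
theorem mem_boundaries_iff {n : ℕ} (I : Composition n) (x : Fin (n + 1)) :
    x ∈ I.boundaries ↔ ∃ i, (I.blocks.take i).sum = x := by
  simp only [Composition.boundaries, Finset.mem_map, Finset.mem_univ, true_and]
  constructor
  · rintro ⟨i, rfl⟩
    exact ⟨i, rfl⟩
  · rintro ⟨i, hi⟩
    rcases le_or_gt i I.length with h | h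
    · exact ⟨⟨i, by omega⟩, Fin.ext hi⟩
    · refine ⟨Fin.last _, Fin.ext ?_⟩
      rw [← hi]
      change I.sizeUpTo _ = I.sizeUpTo _
      rw [I.sizeUpTo_ofLength_le i h.le]
      exact I.sizeUpTo_ofLength_le _ le_rfl

theorem zero_mem_boundaries {n : ℕ} (I : Composition n) : 0 ∈ I.boundaries :=
  I.toCompositionAsSet.zero_mem

theorem last_mem_boundaries {n : ℕ} (I : Composition n) : Fin.last n ∈ I.boundaries :=
  I.toCompositionAsSet.getLast_mem

theorem mem_boundaries_cases {n : ℕ} (I : Composition n) (x : Fin (n + 1)) :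
    x ∈ I.boundaries ↔
      x = 0 ∨ x = Fin.last n ∨ ∃ i ∈ descentEquiv n I, (hi i).castSucc = x := by
  constructor
  · intro hx
    by_cases h0 : x = 0
    · exact Or.inl h0
    by_cases hl : x = Fin.last n
    · exact Or.inr (Or.inl hl)
    have h0' : (x : ℕ) ≠ 0 := fun h => h0 (Fin.ext h)
    have hl' : (x : ℕ) ≠ n := fun h => hl (Fin.ext h)
    have hx' : (hi (⟨x - 1, by omega⟩ : Fin (n - 1))).castSucc = x := by
      ext; simp only [hi, Fin.val_castSucc]; omega
    exact Or.inr (Or.inr ⟨_, (mem_descentEquiv _ _).2 (by rwa [hx']), hx'⟩)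
  · rintro (rfl | rfl | ⟨i, h, rfl⟩)
    · exact zero_mem_boundaries I
    · exact last_mem_boundaries I
    · exact (mem_descentEquiv _ _).1 h

theorem boundaries_subset_iff {n : ℕ} (I J : Composition n) :
    J.boundaries ⊆ I.boundaries ↔ descentEquiv n J ⊆ descentEquiv n I := by
  constructor
  · intro h i hi
    rw [mem_descentEquiv] at hi ⊢
    exact h hi
  · intro h x hx
    rw [mem_boundaries_cases] at hx ⊢
    rcases hx with hx | hx | ⟨i, hi, hx⟩
    · exact Or.inl hx
    · exact Or.inr (Or.inl hx)
    · exact Or.inr (Or.inr ⟨i, h hi, hx⟩)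

/-- The boundaries are the descents together with the two endpoints `0` and `n`, which are distinct
only when `n` is positive. -/
theorem length_eq_card_descentEquiv {n : ℕ} (hn : 0 < n) (I : Composition n) :
    I.length = (descentEquiv n I).card + 1 := by
  have h : I.boundaries = insert 0 (insert (Fin.last n)
      ((descentEquiv n I).image fun i => (hi i).castSucc)) := by
    ext x
    rw [mem_boundaries_cases]
    simp
  have hc := I.card_boundaries_eq_succ_length
  rw [h, Finset.card_insert_of_notMem, Finset.card_insert_of_notMem,
    Finset.card_image_of_injective] at hc
  · omega
  · intro i j hij
    simp only [hi, Fin.ext_iff, Fin.val_castSucc] at hij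
    exact Fin.ext (by omega)
  · simp only [Finset.mem_image, not_exists, not_and]
    intro i _ h
    simp only [hi, Fin.ext_iff, Fin.val_castSucc, Fin.val_last] at h
    omega
  · simp only [Finset.mem_insert, Finset.mem_image, not_or, not_exists, not_and]
    refine ⟨fun h => ?_, fun i _ h => ?_⟩
    · simp only [Fin.ext_iff, Fin.val_last, Fin.val_zero] at h; omega
    · simp [hi, Fin.ext_iff] at h

theorem length_sub_length {n : ℕ} (I J : Composition n) :
    I.length - J.length = (descentEquiv n I).card - (descentEquiv n J).card := by
  rcases Nat.eq_zero_or_pos n with rfl | hn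
  · have : I = J := by
      apply (descentEquiv 0).injective
      ext i; exact i.elim0
    subst this; simp
  · rw [length_eq_card_descentEquiv hn, length_eq_card_descentEquiv hn]
    omega

/-- Möbius inversion in the Boolean lattice: the interval is the powerset of `t \ s`, over which the
signs cancel unless it is empty. -/
theorem sum_Icc_neg_one_pow {α : Type*} [DecidableEq α] (R : Type*) [CommRing R] (s t : Finset α)
    (h : s ⊆ t) :
    ∑ u ∈ Finset.Icc s t, (-1 : R) ^ (u.card - s.card) = if s = t then 1 else 0 := by
  rw [Finset.Icc_eq_image_powerset h, Finset.sum_image]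
  · have h1 : ∀ u ∈ (t \ s).powerset, (-1 : R) ^ ((s ∪ u).card - s.card) = (-1) ^ u.card := by
      intro u hu
      rw [Finset.mem_powerset] at hu
      rw [Finset.card_union_of_disjoint, Nat.add_sub_cancel_left]
      exact (Finset.disjoint_of_subset_left hu Finset.sdiff_disjoint).symm
    rw [Finset.sum_congr rfl h1]
    have h2 := congrArg (Int.cast : ℤ → R)
      (Finset.sum_powerset_neg_one_pow_card (x := t \ s))
    push_cast at h2
    rw [h2]
    have h3 : t \ s = ∅ ↔ s = t := by
      rw [Finset.sdiff_eq_empty_iff_subset]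
      exact ⟨fun h' => h.antisymm h', fun h' => h' ▸ le_rfl⟩
    simp only [h3]
  · intro u hu v hv huv
    rw [Finset.mem_coe, Finset.mem_powerset] at hu hv
    have key : ∀ u ⊆ t \ s, (s ∪ u) \ s = u := by
      intro u hu
      rw [Finset.union_sdiff_left, Finset.sdiff_eq_self_iff_disjoint]
      exact Finset.disjoint_of_subset_left hu Finset.sdiff_disjoint
    rw [← key u hu, ← key v hv]
    exact congrArg (· \ s) huv

/-- The products of complete functions are the sums of the ribbons attached to the coarser
compositions. -/
theorem sum_ribbon (R : Type*) [CommRing R] {n : ℕ} (L : Composition n) :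
    ∑ I : Composition n with descentEquiv n I ⊆ descentEquiv n L, ribbon R I = SComp R L := by
  classical
  simp only [ribbon, Finset.sum_filter]
  rw [← Finset.sum_filter, Finset.sum_comm' (t' := Finset.univ)
    (s' := fun J => {I | descentEquiv n I ⊆ descentEquiv n L}) (by simp)]
  -- After the exchange of sums, the coefficient of `S^J` is an alternating sum over the interval
  -- between the descent sets of `J` and `L`.
  have key : ∀ J : Composition n,
      (∑ I : Composition n with descentEquiv n I ⊆ descentEquiv n L,
        if J.boundaries ⊆ I.boundaries then (-1 : R) ^ (I.length - J.length) • SComp R J else 0) =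
      if J = L then SComp R J else 0 := by
    intro J
    simp only [boundaries_subset_iff, length_sub_length]
    rw [← Finset.sum_filter, Finset.filter_filter, ← Finset.sum_smul]
    have h1 : (∑ I : Composition n with
          descentEquiv n I ⊆ descentEquiv n L ∧ descentEquiv n J ⊆ descentEquiv n I,
          (-1 : R) ^ ((descentEquiv n I).card - (descentEquiv n J).card)) =
        ∑ u ∈ Finset.Icc (descentEquiv n J) (descentEquiv n L),
          (-1 : R) ^ (u.card - (descentEquiv n J).card) := by
      refine Finset.sum_equiv (descentEquiv n) ?_ (fun _ _ => rfl)
      intro I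
      simp [and_comm]
    rw [h1]
    by_cases hJ : descentEquiv n J ⊆ descentEquiv n L
    · rw [sum_Icc_neg_one_pow R _ _ hJ]
      simp only [EmbeddingLike.apply_eq_iff_eq]
      split_ifs <;> simp
    · rw [Finset.Icc_eq_empty hJ, Finset.sum_empty, zero_smul, if_neg]
      rintro rfl; exact hJ le_rfl
  rw [Finset.sum_congr rfl fun J _ => key J]
  simp

/-! ## The composition attached to a sequence of multiplicities -/

/-- Zero entries only repeat a partial sum, so deleting them keeps the set of partial sums. This
lets the descents of `ofMult m` be read off `m` itself. -/
theorem exists_sum_take_filter_pos (l : List ℕ) (x : ℕ) :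
    (∃ i, ((l.filter (0 < ·)).take i).sum = x) ↔ ∃ i, (l.take i).sum = x := by
  induction l generalizing x with
  | nil => simp
  | cons a l ih =>
    have split : ∀ (b : ℕ) (l' : List ℕ), (∃ i, ((b :: l').take i).sum = x) ↔
        0 = x ∨ ∃ y, b + y = x ∧ ∃ i, (l'.take i).sum = y := by
      intro b l'
      constructor
      · rintro ⟨i, hi⟩
        cases i with
        | zero => exact Or.inl (by simpa using hi)
        | succ i => exact Or.inr ⟨_, by simpa using hi, i, rfl⟩
      · rintro (h | ⟨y, h, i, rfl⟩)
        · exact ⟨0, by simpa using h⟩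
        · exact ⟨i + 1, by simpa using h⟩
    rcases Nat.eq_zero_or_pos a with rfl | ha
    · rw [split]
      simp only [lt_irrefl, decide_false, Bool.false_eq_true, not_false_eq_true,
        List.filter_cons_of_neg, zero_add, exists_eq_left, ih]
      constructor
      · exact Or.inr
      · rintro (rfl | h)
        · exact ⟨0, by simp⟩
        · exact h
    · rw [List.filter_cons_of_pos (by simpa using ha), split, split]
      simp only [ih]

/-- The composition obtained by deleting the zeros of a finite sequence. -/
def ofMult {n N : ℕ} (m : Fin N → ℕ) (hm : ∑ j, m j = n) : Composition n where
  blocks := (List.ofFn m).filter (0 < ·)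
  blocks_pos := by intro i hi; simpa using (List.mem_filter.1 hi).2
  blocks_sum := by
    have h : ∀ l : List ℕ, (l.filter (0 < ·)).sum = l.sum := by
      intro l
      induction l with
      | nil => rfl
      | cons a l ih =>
        rcases Nat.eq_zero_or_pos a with rfl | ha
        · simpa using ih
        · rw [List.filter_cons_of_pos (by simpa using ha), List.sum_cons, List.sum_cons, ih]
    rw [h, List.sum_ofFn, hm]

theorem mem_descentEquiv_ofMult {n N : ℕ} (m : Fin N → ℕ) (hm : ∑ j, m j = n) (i : Fin (n - 1)) :
    i ∈ descentEquiv n (ofMult m hm) ↔ ∃ j : Fin N, Fin.partialSum m j.succ = i + 1 := by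
  rw [mem_descentEquiv, mem_boundaries_iff]
  change (∃ k, (((List.ofFn m).filter (0 < ·)).take k).sum = (i : ℕ) + 1) ↔ _
  rw [exists_sum_take_filter_pos]
  constructor
  · rintro ⟨k, hk⟩
    have hN : 0 < N := by
      rcases Nat.eq_zero_or_pos N with rfl | h
      · simp at hk
      · exact h
    cases k with
    | zero => simp at hk
    | succ k =>
      rcases lt_or_ge k N with h | h
      · exact ⟨⟨k, h⟩, hk⟩
      -- A prefix longer than the sequence is the whole sequence, so the last index gives the same
      -- sum.
      · refine ⟨⟨N - 1, by omega⟩, ?_⟩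
        rw [← hk, Fin.partialSum, List.take_of_length_le, List.take_of_length_le]
        · simp; omega
        · simp; omega
  · rintro ⟨j, hj⟩
    exact ⟨j + 1, hj⟩

theorem SComp_ofMult (R : Type*) [CommRing R] {n N : ℕ} (m : Fin N → ℕ) (hm : ∑ j, m j = n) :
    SComp R (ofMult m hm) = (List.ofFn fun j => S R (m j)).prod := by
  have h : ∀ l : List ℕ, ((l.filter (0 < ·)).map (S R)).prod = (l.map (S R)).prod := by
    intro l
    induction l with
    | nil => rfl
    | cons a l ih =>
      rcases Nat.eq_zero_or_pos a with rfl | ha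
      · simpa [S] using ih
      · rw [List.filter_cons_of_pos (by simpa using ha)]
        simp only [List.map_cons, List.prod_cons, ih]
  rw [SComp, ofMult, h, List.map_ofFn]
  rfl

/-! ## Homomorphisms from a permutational module to a simple module -/

theorem Hecke.induction {n : ℕ} {P : Hecke n → Prop} (h1 : ∀ r : ℂ, P (algebraMap ℂ _ r))
    (hT : ∀ i, P (Hecke.T i)) (hmul : ∀ a b, P a → P b → P (a * b))
    (hadd : ∀ a b, P a → P b → P (a + b)) (x : Hecke n) : P x := by
  obtain ⟨y, rfl⟩ := RingQuot.mkAlgHom_surjective ℂ (HeckeRel n) x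
  induction y using FreeAlgebra.induction with
  | grade0 r => rw [AlgHom.commutes]; exact h1 r
  | grade1 i => exact hT i
  | mul a b ha hb => rw [map_mul]; exact hmul _ _ ha hb
  | add a b ha hb => rw [map_add]; exact hadd _ _ ha hb

theorem mem_homToSimple_iff {n : ℕ} {M : Type*} [AddCommGroup M] [Module ℂ M] (ρ : RightRep n M)
    (I : Composition n) (f : Module.Dual ℂ M) :
    f ∈ homToSimple ρ I ↔
      ∀ i m, f ((ρ (Hecke.T i)).unop m) = simpleVal I i * f m := by
  have hT : ∀ i, simpleChar I (Hecke.T i) = simpleVal I i := fun i => Hecke.lift_T _ _ _ _ i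
  constructor
  · intro h i m
    rw [← hT]
    exact h _ m
  · intro h x
    induction x using Hecke.induction with
    | h1 r => intro m; simp [MulOpposite.algebraMap_apply]
    | hT i => intro m; rw [hT]; exact h i m
    | hmul a b ha hb =>
      intro m
      -- The right action reverses the order of the factors; this is harmless because the character
      -- takes commuting values.
      rw [map_mul, MulOpposite.unop_mul, Module.End.mul_apply, hb, ha, map_mul]
      ring
    | hadd a b ha hb =>
      intro m
      rw [map_add, MulOpposite.unop_add, LinearMap.add_apply, map_add, ha, hb, map_add]
      ring

theorem permRep_T {n : ℕ} {W : Finset (Word n)} (hW : Stable W) (i : Fin (n - 1)) :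
    (permRep hW (Hecke.T i)).unop = opT hW i := by
  rw [permRep, Hecke.lift_T, MulOpposite.unop_op]

theorem simpleVal_eq {n : ℕ} (I : Composition n) (i : Fin (n - 1)) :
    simpleVal I i = if i ∈ descentEquiv n I then -1 else 0 := by
  simp only [simpleVal, mem_descentEquiv]

theorem swapWord_swapWord {n : ℕ} {W : Finset (Word n)} (hW : Stable W) (i : Fin (n - 1)) (w : W) :
    swapWord hW i (swapWord hW i w) = w := by
  apply Subtype.ext
  funext k
  simp [swapWord]

theorem swapWord_of_eq {n : ℕ} {W : Finset (Word n)} (hW : Stable W) (i : Fin (n - 1)) (w : W)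
    (h : w.1 (lo i) = w.1 (hi i)) : swapWord hW i w = w := by
  apply Subtype.ext
  funext k
  by_cases k1 : k = lo i
  · subst k1; rw [swapWord_lo, h]
  by_cases k2 : k = hi i
  · subst k2; rw [swapWord_hi, h]
  exact swapWord_of_ne hW i w k k1 k2

/-- A homomorphism to `C_I` is antisymmetric at the descents of `I`, and vanishes on the words
having a descent where `I` does not. -/
theorem mem_homToSimple_permRep_iff {n : ℕ} {W : Finset (Word n)} (hW : Stable W)
    (I : Composition n) (f : Module.Dual ℂ (W →₀ ℂ)) :
    f ∈ homToSimple (permRep hW) I ↔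
      (∀ i ∈ descentEquiv n I, ∀ w : W,
        f (Finsupp.single (swapWord hW i w) 1) = -f (Finsupp.single w 1)) ∧
      ∀ i ∉ descentEquiv n I, ∀ w : W, w.1 (hi i) < w.1 (lo i) → f (Finsupp.single w 1) = 0 := by
  rw [mem_homToSimple_iff]
  simp only [permRep_T]
  constructor
  · intro h
    constructor
    · intro i hiD
      have key : ∀ w : W, w.1 (lo i) < w.1 (hi i) →
          f (Finsupp.single (swapWord hW i w) 1) = -f (Finsupp.single w 1) := by
        intro w hw
        have := h i (Finsupp.single w 1)
        rw [opT_lt hW i w hw, simpleVal_eq, if_pos hiD] at this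
        rw [this]; ring
      intro w
      rcases lt_trichotomy (w.1 (lo i)) (w.1 (hi i)) with hw | hw | hw
      · exact key w hw
      · have := h i (Finsupp.single w 1)
        rw [opT_eq hW i w hw, simpleVal_eq, if_pos hiD, map_zero, neg_one_mul, eq_comm] at this
        rw [swapWord_of_eq hW i w hw, this]
        exact neg_eq_zero.1 this
      · have := key (swapWord hW i w) (by rwa [swapWord_lo, swapWord_hi])
        rw [swapWord_swapWord] at this
        rw [this, neg_neg]
    · intro i hiD w hw
      have := h i (Finsupp.single w 1)
      rw [opT_gt hW i w hw, simpleVal_eq, if_neg hiD, zero_mul, map_neg] at this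
      exact neg_eq_zero.1 this
  · rintro ⟨h1, h2⟩ i m
    suffices f ∘ₗ opT hW i = simpleVal I i • f from LinearMap.congr_fun this m
    ext1 w
    ext1
    simp only [LinearMap.comp_apply, Finsupp.lsingle_apply, LinearMap.smul_apply, smul_eq_mul]
    rw [simpleVal_eq]
    rcases lt_trichotomy (w.1 (lo i)) (w.1 (hi i)) with hw | hw | hw
    · rw [opT_lt hW i w hw]
      split_ifs with hiD
      · rw [h1 i hiD]; ring
      · rw [h2 i hiD _ (by rwa [swapWord_lo, swapWord_hi])]; ring
    · rw [opT_eq hW i w hw]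
      split_ifs with hiD
      · have := h1 i hiD w
        rw [swapWord_of_eq hW i w hw] at this
        rw [self_eq_neg.1 this]; simp
      · simp
    · rw [opT_gt hW i w hw]
      split_ifs with hiD
      · simp
      · rw [map_neg, h2 i hiD w hw]; simp

/-- The nondecreasing words of `W` that increase strictly at the positions in `D`. -/
def sortedWords {n : ℕ} (W : Finset (Word n)) (D : Finset (Fin (n - 1))) : Finset (Word n) :=
  {w ∈ W | Monotone w ∧ ∀ i ∈ D, w (lo i) < w (hi i)}

theorem monotone_of_lo_le_hi {n : ℕ} (w : Word n) (h : ∀ i, w (lo i) ≤ w (hi i)) : Monotone w := by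
  cases n with
  | zero => exact fun i => i.elim0
  | succ n => exact Fin.monotone_iff_le_succ.2 fun i => h i

/-- Take the lexicographically least word on which `f` is nonzero. A descent in `D(I)` could be
exchanged to give a smaller such word, a descent outside `D(I)` forces the value 0, and so does an
equality at a position of `D(I)`. The word is therefore one of those where `f` is assumed to vanish.
-/
theorem eq_zero_of_sortedWords {n : ℕ} {W : Finset (Word n)} (hW : Stable W)
    (I : Composition n) (f : Module.Dual ℂ (W →₀ ℂ)) (hf : f ∈ homToSimple (permRep hW) I)
    (h0 : ∀ w : W, w.1 ∈ sortedWords W (descentEquiv n I) → f (Finsupp.single w 1) = 0) :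
    f = 0 := by
  rw [mem_homToSimple_permRep_iff] at hf
  obtain ⟨h1, h2⟩ := hf
  suffices ∀ w : W, f (Finsupp.single w 1) = 0 by
    ext w
    simpa using this w
  by_contra hne
  push Not at hne
  obtain ⟨w, hw, hmin⟩ := Finset.exists_min_image
    (Finset.univ.filter fun w : W => f (Finsupp.single w 1) ≠ 0)
    (fun w => toLex w.1) ⟨hne.choose, by simpa using hne.choose_spec⟩
  simp only [Finset.mem_filter, Finset.mem_univ, true_and] at hw hmin
  apply hw
  apply h0
  refine Finset.mem_filter.2 ⟨w.2, ?_, ?_⟩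
  · refine monotone_of_lo_le_hi _ fun i => ?_
    by_contra! hlt
    by_cases hiD : i ∈ descentEquiv n I
    · have hle := hmin (swapWord hW i w) (by rw [h1 i hiD]; exact neg_ne_zero.2 hw)
      refine hle.not_gt (Pi.lex_desc ?_ hlt)
      simp [lo, hi, Fin.le_def]
    · exact hw (h2 i hiD w hlt)
  · intro i hiD
    by_contra! hle
    rcases hle.lt_or_eq with hlt | heq
    · have hle' := hmin (swapWord hW i w) (by rw [h1 i hiD]; exact neg_ne_zero.2 hw)
      refine hle'.not_gt (Pi.lex_desc ?_ hlt)
      simp [lo, hi, Fin.le_def]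
    · have := h1 i hiD w
      rw [swapWord_of_eq hW i w heq.symm] at this
      exact hw (self_eq_neg.1 this)

/-- The parabolic subgroup generated by the adjacent transpositions at the positions in `D`. -/
def parabolic {n : ℕ} (D : Finset (Fin (n - 1))) : Subgroup (Equiv.Perm (Fin n)) :=
  Subgroup.closure {σ | ∃ i ∈ D, Equiv.swap (lo i) (hi i) = σ}

/-- No generator crosses the cut after position `i` when `i ∉ D`, so the whole subgroup preserves
the two sides. -/
theorem le_lo_iff_of_mem_parabolic {n : ℕ} {D : Finset (Fin (n - 1))} {σ : Equiv.Perm (Fin n)}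
    (hσ : σ ∈ parabolic D) {i : Fin (n - 1)} (hi : i ∉ D) (k : Fin n) : σ k ≤ lo i ↔ k ≤ lo i := by
  induction hσ using Subgroup.closure_induction generalizing k with
  | mem σ h =>
    obtain ⟨j, hj, rfl⟩ := h
    have hij : (i : ℕ) ≠ j := fun h => hi (Fin.ext h ▸ hj)
    by_cases h1 : k = lo j
    · subst h1
      simp only [Equiv.swap_apply_left, Fin.le_def, lo, NCLagrange.hi]; omega
    by_cases h2 : k = NCLagrange.hi j
    · subst h2
      simp only [Equiv.swap_apply_right, Fin.le_def, lo, NCLagrange.hi]; omega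
    rw [Equiv.swap_apply_of_ne_of_ne h1 h2]
  | one => rfl
  | mul σ τ _ _ h1 h2 => rw [Equiv.Perm.mul_apply, h1, h2]
  | inv σ _ h => rw [← h, show σ (σ⁻¹ k) = k from σ.apply_symm_apply k]

/-- A permutation fixing `w` cannot move `k` to the right: if `k ∈ D`, the strict ascent after `k`
would change the letter, and if not, the cut after `k` is preserved. The same holds for the inverse.
-/
theorem eq_one_of_mem_parabolic {n : ℕ} {D : Finset (Fin (n - 1))} {σ : Equiv.Perm (Fin n)}
    (hσ : σ ∈ parabolic D) {w : Word n} (hw : Monotone w) (hD : ∀ i ∈ D, w (lo i) < w (hi i))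
    (h : w ∘ σ = w) : σ = 1 := by
  have key : ∀ τ ∈ parabolic D, w ∘ τ = w → ∀ k, τ k ≤ k := by
    intro τ hτ hwτ k
    by_contra! hlt
    let i : Fin (n - 1) := ⟨k, by omega⟩
    have hlo : lo i = k := rfl
    by_cases hi : i ∈ D
    · have h1 := hD i hi
      have h2 : w (NCLagrange.hi i) ≤ w (τ k) := hw hlt
      have h3 : w (τ k) = w k := congrFun hwτ k
      rw [h3] at h2
      exact absurd h1 (not_lt.2 h2)
    · exact absurd ((le_lo_iff_of_mem_parabolic hτ hi k).2 le_rfl) (not_le.2 hlt)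
  ext k
  have h1 := key σ hσ h k
  have h2 := key σ⁻¹ (inv_mem hσ) (by
    conv_lhs => rw [← h]
    funext x; simp) (σ k)
  rw [show σ⁻¹ (σ k) = k from σ.symm_apply_apply k] at h2
  exact congrArg Fin.val (le_antisymm h1 h2)

theorem monotone_comp_perm_eq {n : ℕ} {w : Word n} {σ : Equiv.Perm (Fin n)} (h1 : Monotone w)
    (h2 : Monotone (w ∘ σ)) : w ∘ σ = w := by
  have h := Tuple.comp_perm_comp_sort_eq_comp_sort (f := w) (σ := σ)
  rw [Tuple.sort_eq_refl_iff_monotone.2 h1, Tuple.sort_eq_refl_iff_monotone.2 h2] at h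
  exact h

theorem finrank_homToSimple_permRep {n : ℕ} {W : Finset (Word n)} (hW : Stable W)
    (I : Composition n) :
    Module.finrank ℂ (homToSimple (permRep hW) I) = (sortedWords W (descentEquiv n I)).card := by
  classical
  set D := descentEquiv n I with hDdef
  let Φ : homToSimple (permRep hW) I →ₗ[ℂ] (sortedWords W D → ℂ) :=
    { toFun := fun f t => f.1 (Finsupp.single ⟨t.1, (Finset.mem_filter.1 t.2).1⟩ 1)
      map_add' := fun f g => rfl
      map_smul' := fun c f => rfl }
  have hinj : Function.Injective Φ := by
    rw [← LinearMap.ker_eq_bot, LinearMap.ker_eq_bot']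
    intro f hf
    apply Subtype.ext
    exact eq_zero_of_sortedWords hW I f.1 f.2 fun w hw => congrFun hf ⟨w.1, hw⟩
  have hsurj : Function.Surjective Φ := by
    intro g
    let g' : Word n → ℂ := fun w => if h : w ∈ sortedWords W D then g ⟨w, h⟩ else 0
    -- A preimage of `g` is its extension by zero, antisymmetrized over the parabolic subgroup of
    -- `D`.
    let φ : Word n → ℂ := fun u =>
      ∑ σ : parabolic D, ((Equiv.Perm.sign σ.1 : ℤ) : ℂ) * g' (u ∘ σ.1)
    let f : Module.Dual ℂ (W →₀ ℂ) := Finsupp.linearCombination ℂ fun w : W => φ w.1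
    have hfφ : ∀ w : W, f (Finsupp.single w 1) = φ w.1 := fun w => by simp [f]
    have hf : f ∈ homToSimple (permRep hW) I := by
      rw [mem_homToSimple_permRep_iff]
      constructor
      · intro i hiD w
        rw [hfφ, hfφ]
        let s : parabolic D := ⟨Equiv.swap (lo i) (hi i), Subgroup.subset_closure ⟨i, hiD, rfl⟩⟩
        have hne : lo i ≠ hi i := by simp [lo, hi, Fin.ext_iff]
        simp only [φ]
        rw [← Equiv.sum_comp (Equiv.mulLeft s)
          (fun σ : parabolic D => ((Equiv.Perm.sign σ.1 : ℤ) : ℂ) * g' (w.1 ∘ σ.1)),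
          ← Finset.sum_neg_distrib]
        refine Finset.sum_congr rfl fun σ _ => ?_
        simp only [Equiv.coe_mulLeft, Subgroup.coe_mul, s, Equiv.Perm.sign_mul,
          Equiv.Perm.sign_swap hne, swapWord, Equiv.Perm.coe_mul, Function.comp_assoc]
        push_cast
        ring
      · intro i hiD w hlt
        rw [hfφ]
        refine Finset.sum_eq_zero fun σ _ => ?_
        -- `σ` keeps the letters at `lo i` and `hi i` on their sides of the cut, so the larger one
        -- still precedes the smaller and no such rearrangement is sorted.
        have : (w.1 ∘ σ.1) ∉ sortedWords W D := by
          intro hmem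
          have hmono := (Finset.mem_filter.1 hmem).2.1
          have hσ' := inv_mem σ.2
          have h1 := (le_lo_iff_of_mem_parabolic hσ' hiD (lo i)).2 le_rfl
          have h2 : ¬ (σ.1⁻¹ (hi i) ≤ lo i) := by
            rw [le_lo_iff_of_mem_parabolic hσ' hiD]
            simp [lo, hi, Fin.le_def]
          have h3 := hmono (h1.trans (not_le.1 h2).le)
          have hinv : ∀ x, σ.1 (σ.1⁻¹ x) = x := σ.1.apply_symm_apply
          simp only [Function.comp_apply, hinv] at h3
          omega
        simp [g', this]
    refine ⟨⟨f, hf⟩, ?_⟩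
    funext t
    have ht := Finset.mem_filter.1 t.2
    change f (Finsupp.single ⟨t.1, ht.1⟩ 1) = g t
    rw [hfφ]
    simp only [φ]
    -- A sorted rearrangement of the sorted word `t` is `t` itself, and its stabilizer in the
    -- parabolic subgroup is trivial: only the identity contributes.
    rw [Finset.sum_eq_single 1]
    · simp [g']
    · intro σ _ hσ
      have : (t.1 ∘ σ.1) ∉ sortedWords W D := by
        intro hmem
        have hmono := (Finset.mem_filter.1 hmem).2.1
        exact hσ (Subtype.ext (eq_one_of_mem_parabolic σ.2 ht.2.1 ht.2.2
          (monotone_comp_perm_eq ht.2.1 hmono)))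
      simp [g', this]
    · simp
  rw [(LinearEquiv.ofBijective Φ ⟨hinj, hsurj⟩).finrank_eq, Module.finrank_fintype_fun_eq_card,
    Fintype.card_coe]

/-! ## The characteristic of a permutational module -/

/-- The positions where a word increases strictly. -/
def ascents {n : ℕ} (w : Word n) : Finset (Fin (n - 1)) :=
  {i | w (lo i) < w (hi i)}

/-- The composition whose descents are the strict ascents of a word. -/
def ascentComp {n : ℕ} (w : Word n) : Composition n :=
  (descentEquiv n).symm (ascents w)

/-- A nondecreasing word is counted in the multiplicity of `R_I` exactly when `D(I)` lies in its set
of ascents; `sum_ribbon` adds up these ribbons. -/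
theorem ch_permRep (R : Type*) [CommRing R] {n : ℕ} {W : Finset (Word n)} (hW : Stable W) :
    ch R (permRep hW) = ∑ w ∈ W with Monotone w, SComp R (ascentComp w) := by
  classical
  simp only [ch, finrank_homToSimple_permRep, ← Finset.sum_const]
  simp only [← sum_ribbon, ascentComp, Equiv.apply_symm_apply]
  refine Finset.sum_comm' fun I w => ?_
  simp [sortedWords, ascents, Finset.subset_iff]
  tauto

theorem chq_eq {R : Type*} [CommRing R] (q : R) {n : ℕ} {W : Finset (Word n)} (hW : Stable W) :
    chq q hW = ∑ w ∈ W with Monotone w, q ^ weight w • SComp R (ascentComp w) := by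
  classical
  simp only [chq, ch_permRep, Finset.smul_sum]
  rw [← Finset.sum_fiberwise_of_maps_to (s := W.filter Monotone) (t := W.image weight)
    (g := weight) (fun w hw => Finset.mem_image_of_mem _ (Finset.mem_filter.1 hw).1)]
  refine Finset.sum_congr rfl fun k _ => ?_
  rw [Finset.filter_comm]
  refine Finset.sum_congr rfl fun w hw => ?_
  rw [(Finset.mem_filter.1 hw).2]

theorem chq_one (R : Type*) [CommRing R] {n : ℕ} {W : Finset (Word n)} (hW : Stable W) :
    chq (1 : R) hW = ch R (permRep hW) := by
  simp [chq_eq, ch_permRep]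

/-! ## Sorted words and multiplicities -/

/-- The multiplicities of the letters `1, …, n` in a word. -/
def multOf {n : ℕ} (w : Word n) (j : Fin n) : ℕ :=
  Finset.card {i | w i = j + 1}

/-- The nondecreasing word with given multiplicities. -/
def wordOf {n : ℕ} (m : Fin n → ℕ) : Word n :=
  fun i => 1 + Finset.card {j : Fin n | Fin.partialSum m j.succ ≤ i}

theorem monotone_partialSum {n : ℕ} (m : Fin n → ℕ) : Monotone (Fin.partialSum m) :=
  Fin.monotone_iff_le_succ.2 fun i => by rw [Fin.partialSum_succ]; omega

theorem partialSum_last {n : ℕ} (m : Fin n → ℕ) :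
    Fin.partialSum m (Fin.last n) = ∑ j, m j := by
  simp [Fin.partialSum, List.sum_ofFn, List.take_of_length_le]

/-- The thresholds on both sides determine the word and the multiplicities respectively, so this
equivalence yields both inverse laws. Its diagonal case `j = i` turns the parking condition into the
condition on partial sums. -/
theorem wordOf_le_iff {n : ℕ} (m : Fin n → ℕ) (i j : Fin n) :
    wordOf m i ≤ j + 1 ↔ (i : ℕ) < Fin.partialSum m j.succ := by
  constructor
  · intro h
    by_contra! hle
    have hsub : Finset.Iic j ⊆ ({j' : Fin n | Fin.partialSum m j'.succ ≤ i} : Finset _) := by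
      intro j' hj'
      rw [Finset.mem_Iic] at hj'
      simp only [Finset.mem_filter, Finset.mem_univ, true_and]
      exact (monotone_partialSum m (Fin.succ_le_succ_iff.2 hj')).trans hle
    have := Finset.card_le_card hsub
    rw [Fin.card_Iic] at this
    simp only [wordOf] at h
    omega
  · intro h
    have hsub : ({j' : Fin n | Fin.partialSum m j'.succ ≤ i} : Finset _) ⊆ Finset.Iio j := by
      intro j' hj'
      simp only [Finset.mem_filter, Finset.mem_univ, true_and] at hj'
      rw [Finset.mem_Iio]
      by_contra! hle
      have := monotone_partialSum m (Fin.succ_le_succ_iff.2 hle)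
      omega
    have := Finset.card_le_card hsub
    rw [Fin.card_Iio] at this
    simp only [wordOf]
    omega

theorem partialSum_multOf {n : ℕ} (w : Word n) (hw : ∀ i, 1 ≤ w i) (k : Fin (n + 1)) :
    Fin.partialSum (multOf w) k = Finset.card {i | w i ≤ k} := by
  induction k using Fin.induction with
  | zero =>
    rw [Fin.partialSum_zero, eq_comm, Finset.card_eq_zero, Finset.filter_eq_empty_iff]
    intro i _
    have := hw i
    simp only [Fin.val_zero]; omega
  | succ j ih =>
    rw [Fin.partialSum_succ, ih, multOf, ← Finset.card_union_of_disjoint]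
    · congr 1
      ext i
      simp only [Finset.mem_union, Finset.mem_filter, Finset.mem_univ, true_and, Fin.val_succ,
        Fin.val_castSucc]
      omega
    · rw [Finset.disjoint_filter]
      intro i _ h
      simp only [Fin.val_castSucc] at h
      omega

theorem le_iff_lt_card {n : ℕ} {w : Word n} (hw : Monotone w) (c : ℕ) (i : Fin n) :
    w i ≤ c ↔ (i : ℕ) < Finset.card {i | w i ≤ c} := by
  constructor
  · intro h
    have hsub : Finset.Iic i ⊆ ({i | w i ≤ c} : Finset _) := by
      intro i' hi'
      simp only [Finset.mem_filter, Finset.mem_univ, true_and]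
      exact (hw (Finset.mem_Iic.1 hi')).trans h
    have := Finset.card_le_card hsub
    rw [Fin.card_Iic] at this
    omega
  · intro h
    by_contra! hlt
    have hsub : ({i | w i ≤ c} : Finset _) ⊆ Finset.Iio i := by
      intro i' hi'
      simp only [Finset.mem_filter, Finset.mem_univ, true_and] at hi'
      rw [Finset.mem_Iio]
      by_contra! hle
      have := hw hle
      omega
    have := Finset.card_le_card hsub
    rw [Fin.card_Iio] at this
    omega

theorem le_iff_lt_partialSum_multOf {n : ℕ} {w : Word n} (hw : Monotone w) (h1 : ∀ i, 1 ≤ w i)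
    (i j : Fin n) : w i ≤ j + 1 ↔ (i : ℕ) < Fin.partialSum (multOf w) j.succ := by
  rw [partialSum_multOf w h1, le_iff_lt_card hw, Fin.val_succ]

theorem sum_multOf {n : ℕ} {w : Word n} (h1 : ∀ i, 1 ≤ w i) (h2 : ∀ i, w i ≤ n) :
    ∑ j, multOf w j = n := by
  rw [← partialSum_last, partialSum_multOf w h1, Finset.filter_true_of_mem]
  · simp
  · intro i _
    exact h2 i

theorem one_le_wordOf {n : ℕ} (m : Fin n → ℕ) (i : Fin n) : 1 ≤ wordOf m i :=
  Nat.le_add_right _ _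

theorem wordOf_le {n : ℕ} {m : Fin n → ℕ} (hm : ∑ j, m j = n) (i : Fin n) : wordOf m i ≤ n := by
  have hn : n - 1 < n := by have := i.2; omega
  have h := (wordOf_le_iff m i ⟨n - 1, hn⟩).2 (by
    have : (⟨n - 1, hn⟩ : Fin n).succ = Fin.last n := by ext; simp; omega
    rw [this, partialSum_last, hm]
    exact i.2)
  simp only at h
  omega

theorem monotone_wordOf {n : ℕ} (m : Fin n → ℕ) : Monotone (wordOf m) := by
  intro i i' h
  refine Nat.add_le_add_left (Finset.card_le_card ?_) 1
  intro j hj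
  simp only [Finset.mem_filter, Finset.mem_univ, true_and] at hj ⊢
  exact hj.trans h

theorem wordOf_multOf {n : ℕ} {w : Word n} (hw : Monotone w) (h1 : ∀ i, 1 ≤ w i)
    (h2 : ∀ i, w i ≤ n) : wordOf (multOf w) = w := by
  funext i
  have h3 := one_le_wordOf (multOf w) i
  have h4 := wordOf_le (sum_multOf h1 h2) i
  have key : ∀ j : Fin n, wordOf (multOf w) i ≤ j + 1 ↔ w i ≤ j + 1 := fun j => by
    rw [wordOf_le_iff, le_iff_lt_partialSum_multOf hw h1]
  have h5 := h1 i
  have h6 := h2 i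
  have h7 := key ⟨wordOf (multOf w) i - 1, by omega⟩
  have h8 := key ⟨w i - 1, by omega⟩
  simp only at h7 h8
  omega

theorem partialSum_le {n : ℕ} {m : Fin n → ℕ} (hm : ∑ j, m j = n) (k : Fin (n + 1)) :
    Fin.partialSum m k ≤ n := by
  have := monotone_partialSum m (Fin.le_last k)
  rwa [partialSum_last, hm] at this

theorem multOf_wordOf {n : ℕ} {m : Fin n → ℕ} (hm : ∑ j, m j = n) : multOf (wordOf m) = m := by
  have key : ∀ k, Fin.partialSum (multOf (wordOf m)) k = Fin.partialSum m k := by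
    intro k
    cases k using Fin.cases with
    | zero => simp
    | succ j =>
      rw [partialSum_multOf _ (one_le_wordOf m)]
      simp only [Fin.val_succ, wordOf_le_iff]
      exact Fin.card_filter_val_lt.trans (min_eq_right (partialSum_le hm _))
  funext j
  have h1 := key j.succ
  rw [Fin.partialSum_succ, Fin.partialSum_succ, key] at h1
  omega

theorem ascentComp_eq_ofMult {n : ℕ} {w : Word n} (hw : Monotone w) (h1 : ∀ i, 1 ≤ w i)
    (h2 : ∀ i, w i ≤ n) : ascentComp w = ofMult (multOf w) (sum_multOf h1 h2) := by
  rw [ascentComp, Equiv.symm_apply_eq]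
  ext i
  rw [mem_descentEquiv_ofMult]
  simp only [ascents, Finset.mem_filter, Finset.mem_univ, true_and]
  have key := le_iff_lt_partialSum_multOf hw h1
  have hlo : ((lo i : Fin n) : ℕ) = i := rfl
  have hhi : ((hi i : Fin n) : ℕ) = i + 1 := rfl
  constructor
  · intro h
    have h3 := h1 (lo i)
    have h4 := h2 (lo i)
    refine ⟨⟨w (lo i) - 1, by omega⟩, ?_⟩
    have h5 := key (lo i) ⟨w (lo i) - 1, by omega⟩
    have h6 := key (hi i) ⟨w (lo i) - 1, by omega⟩
    simp only [hlo, hhi] at h5 h6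
    omega
  · rintro ⟨j, hj⟩
    have h5 := key (lo i) j
    have h6 := key (hi i) j
    simp only [hlo, hhi] at h5 h6
    omega

/-- Double counting: a letter `c` gives `c - 1` to the weight and is counted in the `n - (c - 1)`
partial sums from index `c` on. -/
theorem weight_add_sum_partialSum {n : ℕ} {w : Word n} (h1 : ∀ i, 1 ≤ w i) (h2 : ∀ i, w i ≤ n) :
    weight w + ∑ j : Fin n, Fin.partialSum (multOf w) j.succ = n * n := by
  simp only [partialSum_multOf w h1, Fin.val_succ, Finset.card_filter]
  rw [Finset.sum_comm, weight, ← Finset.sum_add_distrib]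
  have key : ∀ i, w i - 1 + ∑ j : Fin n, (if w i ≤ (j : ℕ) + 1 then 1 else 0) = n := by
    intro i
    rw [← Finset.card_filter]
    have h3 := h1 i
    have h4 := h2 i
    have h5 : ({j : Fin n | w i ≤ (j : ℕ) + 1} : Finset _) = Finset.Ici ⟨w i - 1, by omega⟩ := by
      ext j
      simp only [Finset.mem_filter, Finset.mem_univ, true_and, Finset.mem_Ici, Fin.le_def]
      omega
    rw [h5, Fin.card_Ici]
    simp only
    omega
  rw [Finset.sum_congr rfl fun i _ => key i]
  simp

theorem mem_PF_iff {n : ℕ} {w : Word n} (hw : Monotone w) :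
    w ∈ PF n ↔ (∀ i, 1 ≤ w i ∧ w i ≤ n) ∧ ∀ i, w i ≤ (i : ℕ) + 1 := by
  simp [PF, Tuple.sort_eq_refl_iff_monotone.2 hw]

theorem sum_partialSum_sub {n : ℕ} (P : Fin n → ℕ) (hP : ∀ j : Fin n, (j : ℕ) + 1 ≤ P j) (a : ℕ)
    (h : a + ∑ j, P j = n * n) : a + ∑ j : Fin n, (P j - j) = (n + 1).choose 2 := by
  have h1 : ∑ j, P j = ∑ j : Fin n, (P j - j) + ∑ j : Fin n, (j : ℕ) := by
    rw [← Finset.sum_add_distrib]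
    refine Finset.sum_congr rfl fun j _ => ?_
    have := hP j
    omega
  have h2 : ∑ j : Fin n, (j : ℕ) = n.choose 2 := by
    rw [Fin.sum_univ_eq_sum_range fun j => j, Finset.sum_range_id, Nat.choose_two_right]
  have h3 : (n + 1).choose 2 = n + n.choose 2 := by
    rw [Nat.choose_succ_succ' n 1, Nat.choose_one_right]
  have h4 : n * n = n + 2 * n.choose 2 := by
    rw [Nat.choose_two_right, Nat.mul_div_cancel' (Nat.even_mul_pred_self n).two_dvd]
    cases n with
    | zero => rfl
    | succ n => simp only [Nat.add_sub_cancel]; ring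
  omega

/-- Up to the normalization, the `q⁻¹`-characteristic of the parking functions enumerates
the Łukasiewicz words by area. -/
theorem pow_choose_smul_chq {R : Type*} [CommRing R] (q : Rˣ) (n : ℕ) :
    (q : R) ^ (n + 1).choose 2 • chq ((q⁻¹ : Rˣ) : R) (PF_stable n) =
      ∑ m ∈ Finset.Nat.antidiagonalTuple n n with
          ∀ j : Fin n, (j : ℕ) + 1 ≤ Fin.partialSum m j.succ,
        (q : R) ^ (∑ j : Fin n, (Fin.partialSum m j.succ - j)) •
          (List.ofFn fun j => S R (m j)).prod := by
  rw [chq_eq, Finset.smul_sum]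
  refine Finset.sum_nbij' multOf wordOf ?_ ?_ ?_ ?_ ?_
  · intro w hw
    obtain ⟨hPF, hmono⟩ := Finset.mem_filter.1 hw
    obtain ⟨h12, h3⟩ := (mem_PF_iff hmono).1 hPF
    refine Finset.mem_filter.2 ⟨Finset.Nat.mem_antidiagonalTuple.2
      (sum_multOf (fun i => (h12 i).1) fun i => (h12 i).2), fun j => ?_⟩
    exact (le_iff_lt_partialSum_multOf hmono (fun i => (h12 i).1) j j).1 (h3 j)
  · intro m hm
    obtain ⟨hs, h⟩ := Finset.mem_filter.1 hm
    rw [Finset.Nat.mem_antidiagonalTuple] at hs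
    refine Finset.mem_filter.2 ⟨(mem_PF_iff (monotone_wordOf m)).2
      ⟨fun i => ⟨one_le_wordOf m i, wordOf_le hs i⟩, fun i => ?_⟩, monotone_wordOf m⟩
    exact (wordOf_le_iff m i i).2 (h i)
  · intro w hw
    obtain ⟨hPF, hmono⟩ := Finset.mem_filter.1 hw
    obtain ⟨h12, h3⟩ := (mem_PF_iff hmono).1 hPF
    exact wordOf_multOf hmono (fun i => (h12 i).1) fun i => (h12 i).2
  · intro m hm
    exact multOf_wordOf (Finset.Nat.mem_antidiagonalTuple.1 (Finset.mem_filter.1 hm).1)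
  · intro w hw
    obtain ⟨hPF, hmono⟩ := Finset.mem_filter.1 hw
    obtain ⟨h12, h3⟩ := (mem_PF_iff hmono).1 hPF
    rw [ascentComp_eq_ofMult hmono (fun i => (h12 i).1) (fun i => (h12 i).2), SComp_ofMult,
      smul_smul]
    congr 1
    -- Weight and area add up to the binomial coefficient, so `q⁻¹` to the weight cancels and leaves
    -- `q` to the area.
    rw [← sum_partialSum_sub (fun j => Fin.partialSum (multOf w) j.succ)
      (fun j => (le_iff_lt_partialSum_multOf hmono (fun i => (h12 i).1) j j).1 (h3 j)) (weight w)
      (weight_add_sum_partialSum (fun i => (h12 i).1) fun i => (h12 i).2), pow_add,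
      mul_right_comm, ← mul_pow, Units.mul_inv, one_pow, one_mul]

/-! ## Enumeration of Łukasiewicz paths -/

/-- The sum of the paths of length `N` going from height `h` to height `0`, which stay positive
before, a step of height `k - 1` being recorded by `S_k` and each step starting at height `h`
by `q ^ h`. -/
def lukSum {R : Type*} [CommRing R] (q : R) : ℕ → ℕ → NSym R
  | 0, 0 => 1
  | 0, _ + 1 => 0
  | _ + 1, 0 => 0
  | N + 1, h + 1 => q ^ (h + 1) • ∑ k ∈ Finset.range (N + 1), S R k * lukSum q N (h + k)

section

variable {R : Type*} [CommRing R] (q : R)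

@[simp] theorem lukSum_zero_zero : lukSum q 0 0 = 1 := by rw [lukSum]

@[simp] theorem lukSum_zero_succ (h : ℕ) : lukSum q 0 (h + 1) = 0 := by rw [lukSum]

@[simp] theorem lukSum_succ_zero (N : ℕ) : lukSum q (N + 1) 0 = 0 := by rw [lukSum]

theorem lukSum_succ_succ (N h : ℕ) : lukSum q (N + 1) (h + 1) =
    q ^ (h + 1) • ∑ k ∈ Finset.range (N + 1), S R k * lukSum q N (h + k) := by rw [lukSum]

/-- A step descends by at most 1. Hence the truncation of the sum in `lukSum` loses no path. -/
theorem lukSum_eq_zero {N h : ℕ} (hN : N < h) : lukSum q N h = 0 := by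
  induction N generalizing h with
  | zero =>
    obtain ⟨h, rfl⟩ := Nat.exists_eq_add_of_lt hN
    simp
  | succ N ih =>
    cases h with
    | zero => omega
    | succ h =>
      rw [lukSum_succ_succ, Finset.sum_eq_zero, smul_zero]
      intro k _
      rw [ih (by omega), mul_zero]

theorem sum_range_lukSum {N h M : ℕ} (hM : N < h + M) {M' : ℕ} (hM' : M ≤ M') :
    ∑ k ∈ Finset.range M, S R k * lukSum q N (h + k) =
      ∑ k ∈ Finset.range M', S R k * lukSum q N (h + k) := by
  refine Finset.sum_subset (Finset.range_subset_range.2 hM') fun k _ hk => ?_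
  rw [Finset.mem_range, not_lt] at hk
  rw [lukSum_eq_zero q (by omega), mul_zero]

/-- Since heights drop by at most 1, a path from `a + b` must visit `b`; cut it at the first visit.
Each of the `p.1` earlier steps starts `b` higher than in the path from `a`, whence the factor `(q ^
b) ^ p.1`. The induction removes the first step. -/
theorem lukSum_add (N a b : ℕ) : lukSum q N (a + b) =
    ∑ p ∈ Finset.HasAntidiagonal.antidiagonal N, (q ^ b) ^ p.1 • lukSum q p.1 a * lukSum q p.2 b := by
  induction N generalizing a with
  | zero =>
    cases a <;> simp [Nat.succ_add]
  | succ N ih =>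
    rw [Finset.Nat.sum_antidiagonal_succ]
    cases a with
    | zero =>
      rw [Finset.sum_eq_zero]
      · simp
      · intro p _; simp
    | succ a =>
      rw [show a + 1 + b = a + b + 1 by ring, lukSum_succ_succ, lukSum_zero_succ, smul_zero,
        zero_mul, zero_add]
      have h1 : ∀ k, lukSum q N (a + b + k) = ∑ p ∈ Finset.HasAntidiagonal.antidiagonal N,
          (q ^ b) ^ p.1 • lukSum q p.1 (a + k) * lukSum q p.2 b := fun k => by
        rw [← ih, Nat.add_right_comm]
      simp only [h1, Finset.mul_sum]
      rw [Finset.sum_comm, Finset.smul_sum]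
      refine Finset.sum_congr rfl fun p hp => ?_
      rw [Finset.HasAntidiagonal.mem_antidiagonal] at hp
      rw [lukSum_succ_succ, sum_range_lukSum q (M' := N + 1) (by omega) (by omega), smul_smul,
        smul_mul_assoc, Finset.sum_mul, Finset.smul_sum, Finset.smul_sum]
      refine Finset.sum_congr rfl fun k _ => ?_
      rw [smul_mul_assoc, mul_smul_comm, smul_smul, mul_assoc]
      congr 1
      ring

theorem sum_antidiagonalTuple_succ {A : Type*} [AddCommMonoid A] (n s : ℕ)
    (f : (Fin (n + 1) → ℕ) → A) :
    ∑ m ∈ Finset.Nat.antidiagonalTuple (n + 1) s, f m =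
      ∑ k ∈ Finset.range (s + 1), ∑ m ∈ Finset.Nat.antidiagonalTuple n (s - k),
        f (Fin.cons k m) := by
  rw [Finset.sum_sigma']
  refine Finset.sum_nbij' (fun m => ⟨m 0, Fin.tail m⟩) (fun x => Fin.cons x.1 x.2) ?_ ?_ ?_ ?_ ?_
  · intro m hm
    rw [Finset.Nat.mem_antidiagonalTuple, Fin.sum_univ_succ] at hm
    simp only [Finset.mem_sigma, Finset.mem_range, Finset.Nat.mem_antidiagonalTuple, Fin.tail]
    omega
  · rintro ⟨k, m⟩ hm
    simp only [Finset.mem_sigma, Finset.mem_range, Finset.Nat.mem_antidiagonalTuple] at hm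
    rw [Finset.Nat.mem_antidiagonalTuple, Fin.sum_univ_succ]
    simp only [Fin.cons_zero, Fin.cons_succ]
    omega
  · intro m _
    exact Fin.cons_self_tail m
  · rintro ⟨k, m⟩ _
    simp
  · intro m _
    simp

/-- The left side encodes `n + 1` steps starting at height `h + 1`, without the weight of the first
one. The last step must go from 1 to 0 and is recorded by `S_0 = 1`, so `n` factors remain. The
height after step `j` (counted from 0) is `h + Fin.partialSum m j.succ - j`. -/
theorem sum_lukSum_eq (n h s : ℕ) (hs : h + s = n) :
    ∑ k ∈ Finset.range (n + 1), S R k * lukSum q n (h + k) =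
      ∑ m ∈ Finset.Nat.antidiagonalTuple n s with
          ∀ j : Fin n, (j : ℕ) + 1 ≤ h + Fin.partialSum m j.succ,
        q ^ (∑ j : Fin n, (h + Fin.partialSum m j.succ - j)) •
          (List.ofFn fun j => S R (m j)).prod := by
  induction n generalizing h s with
  | zero =>
    obtain ⟨rfl, rfl⟩ : h = 0 ∧ s = 0 := by omega
    simp [S]
  | succ n ih =>
    rw [Finset.sum_filter, sum_antidiagonalTuple_succ,
      ← sum_range_lukSum q (M := s + 1) (by omega) (by omega)]
    refine Finset.sum_congr rfl fun k hk => ?_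
    rw [Finset.mem_range] at hk
    have hcond : ∀ m : Fin n → ℕ,
        (∀ j : Fin (n + 1), (j : ℕ) + 1 ≤ h + Fin.partialSum (Fin.cons k m : Fin (n + 1) → ℕ) j.succ) ↔
          1 ≤ h + k ∧ ∀ j : Fin n, (j : ℕ) + 1 ≤ (h + k - 1) + Fin.partialSum m j.succ := by
      intro m
      simp only [Fin.partialSum_succ', Fin.cons_zero, Fin.tail_cons]
      rw [Fin.forall_fin_succ]
      simp only [Fin.partialSum_zero, Fin.val_zero, Fin.val_succ]
      constructor
      · rintro ⟨h1, h2⟩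
        exact ⟨by omega, fun j => by have := h2 j; omega⟩
      · rintro ⟨h1, h2⟩
        exact ⟨by omega, fun j => by have := h2 j; omega⟩
    simp only [hcond]
    rcases Nat.eq_zero_or_pos (h + k) with h0 | h0
    · rw [h0, lukSum_succ_zero, mul_zero, Finset.sum_eq_zero]
      intro m _
      rw [if_neg (by omega)]
    · obtain ⟨h', hh'⟩ : ∃ h', h + k = h' + 1 := ⟨h + k - 1, by omega⟩
      rw [hh', lukSum_succ_succ, ih h' (s - k) (by omega)]
      simp only [Nat.le_add_left, true_and, Nat.add_sub_cancel]
      rw [← Finset.sum_filter, Finset.smul_sum, Finset.mul_sum]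
      refine Finset.sum_congr rfl fun m _ => ?_
      rw [mul_smul_comm, mul_smul_comm, smul_smul, List.ofFn_succ, List.prod_cons, Fin.cons_zero,
        Fin.sum_univ_succ, ← pow_add]
      simp only [Fin.cons_succ, Fin.partialSum_succ', Fin.cons_zero, Fin.tail_cons,
        Fin.partialSum_zero, Fin.val_zero, Fin.val_succ]
      congr 2
      congr 1
      · omega
      · refine Finset.sum_congr rfl fun j _ => ?_
        omega

end

/-! ## The functional equations -/

section

variable {R : Type*} [CommRing R]

theorem coeff_K (q : Rˣ) (N : ℕ) : PowerSeries.coeff N (K q) = lukSum (q : R) N 1 := by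
  cases N with
  | zero => simp [K]
  | succ N =>
    rw [K, PowerSeries.coeff_succ_X_mul, PowerSeries.coeff_smul, G, PowerSeries.coeff_mk, inv_inv,
      Units.val_pow_eq_pow_val, pow_choose_smul_chq, lukSum_succ_succ,
      sum_lukSum_eq (q : R) N 0 N (zero_add N)]
    simp only [zero_add, pow_one]

theorem coeff_qPow_K (q : Rˣ) (n N : ℕ) :
    PowerSeries.coeff N (qPow (q : R) (K q) n) = lukSum (q : R) N n := by
  induction n generalizing N with
  | zero =>
    rw [qPow, PowerSeries.coeff_one]
    cases N <;> simp
  | succ n ih =>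
    rw [qPow, PowerSeries.coeff_mul, add_comm n 1, lukSum_add]
    refine Finset.sum_congr rfl fun p _ => ?_
    rw [ih, dilate, PowerSeries.coeff_mk, coeff_K]

theorem K_functional_equation (q : Rˣ) : ∃ L : (NSym R)⟦X⟧,
    FormalHasSum (fun n => PowerSeries.C (S R n) * qPow (q : R) (K q) n) L ∧
      K q = (q : R) • (PowerSeries.X * L) := by
  -- In degree `N` only `n ≤ N` contributes, as a path from height `n` has at least `n` steps.
  refine ⟨PowerSeries.mk fun N => ∑ k ∈ Finset.range (N + 1), S R k * lukSum (q : R) N k, ?_, ?_⟩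
  · intro N
    filter_upwards [Filter.eventually_ge_atTop (Finset.range (N + 1))] with s hs
    simp only [map_sum, PowerSeries.coeff_C_mul, coeff_qPow_K, PowerSeries.coeff_mk]
    refine (Finset.sum_subset hs fun k _ hk => ?_).symm
    rw [Finset.mem_range, not_lt] at hk
    rw [lukSum_eq_zero _ (by omega), mul_zero]
  · ext1 N
    rw [coeff_K, PowerSeries.coeff_smul]
    cases N with
    | zero => simp
    | succ N =>
      rw [PowerSeries.coeff_succ_X_mul, PowerSeries.coeff_mk, lukSum_succ_succ]
      simp only [zero_add, pow_one]

theorem coeff_G_one (n : ℕ) :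
    PowerSeries.coeff n (G (1 : Rˣ)) = ch R (permRep (PF_stable n)) := by
  simp [G, chq_one]

theorem qPow_one (f : (NSym R)⟦X⟧) (n : ℕ) : qPow (1 : R) f n = f ^ n := by
  have h : dilate (1 : R) f = f := by ext1 N; simp [dilate]
  induction n with
  | zero => rfl
  | succ n ih => rw [qPow, ih, one_pow, h, pow_succ']

theorem coe_gPF : (gPF R : (NSym R)⟦X⟧) = G (1 : Rˣ) := by
  ext1 n
  rw [coeff_G_one, gPF, NSymHat.ofComponents, PowerSeries.coeff_mk]

theorem K_one : K (1 : Rˣ) = PowerSeries.X * (gPF R : (NSym R)⟦X⟧) := by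
  rw [coe_gPF, K, Units.val_one, one_smul, inv_one]

theorem coe_ofHomog_mul_pow (g : NSymHat R) (n : ℕ) (a : homog R n) :
    ((NSymHat.ofHomog n a * g ^ n : NSymHat R) : (NSym R)⟦X⟧) =
      PowerSeries.X ^ n * (PowerSeries.C (a : NSym R) * (g : (NSym R)⟦X⟧) ^ n) := by
  rw [MulMemClass.coe_mul, SubmonoidClass.coe_pow, ← mul_assoc, ← (PowerSeries.commute_X_pow _ n).eq]
  congr 1
  change PowerSeries.monomial n (a : NSym R) = _
  ext1 m
  rw [PowerSeries.coeff_monomial, PowerSeries.coeff_C_mul, PowerSeries.coeff_X_pow]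
  split_ifs <;> simp

theorem lagrangeEq_gPF : LagrangeEq (gPF R) := by
  obtain ⟨L, hL, hK⟩ := K_functional_equation (1 : Rˣ)
  rw [Units.val_one, one_smul, K_one] at hK
  have hg : (gPF R : (NSym R)⟦X⟧) = L := by
    ext1 N
    have := congrArg (PowerSeries.coeff (N + 1)) hK
    rwa [PowerSeries.coeff_succ_X_mul, PowerSeries.coeff_succ_X_mul] at this
  rw [← hg] at hL
  unfold LagrangeEq NSymHat.HasSum
  convert hL using 2 with n
  -- The variable `x` now plays the role of the degree marker: `S_n (x g)^n` is `S_n x^n` times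
  -- `g^n`.
  rw [coe_ofHomog_mul_pow, Units.val_one, qPow_one, K_one, (PowerSeries.commute_X _).symm.mul_pow,
    ← mul_assoc, ← mul_assoc, (PowerSeries.commute_X_pow _ n).eq]

end

theorem coeff_pow_congr {A : Type*} [Semiring A] {f g : A⟦X⟧} {N : ℕ}
    (h : ∀ i ≤ N, PowerSeries.coeff i f = PowerSeries.coeff i g) (n : ℕ) :
    ∀ i ≤ N, PowerSeries.coeff i (f ^ n) = PowerSeries.coeff i (g ^ n) := by
  induction n with
  | zero => simp
  | succ n ih =>
    intro i hi
    rw [pow_succ, pow_succ, PowerSeries.coeff_mul, PowerSeries.coeff_mul]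
    refine Finset.sum_congr rfl fun p hp => ?_
    rw [Finset.HasAntidiagonal.mem_antidiagonal] at hp
    rw [ih _ (by omega), h _ (by omega)]

theorem LagrangeEq.unique {R : Type*} [CommRing R] {f g : NSymHat R} (hf : LagrangeEq f)
    (hg : LagrangeEq g) : f = g := by
  apply Subtype.ext
  ext1 N
  induction N using Nat.strong_induction_on with
  | _ N ih =>
    -- One finite set of indices computes the degree `N` coefficient of both solutions. There the
    -- term `n = 0` does not involve the solution, and a term with `n > 0` involves only its
    -- components of degree at most `N - n`.
    obtain ⟨s, hs1, hs2⟩ := ((hf N).and (hg N)).exists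
    rw [← hs1, ← hs2, map_sum, map_sum]
    refine Finset.sum_congr rfl fun n _ => ?_
    simp only [coe_ofHomog_mul_pow, PowerSeries.coeff_X_pow_mul', PowerSeries.coeff_C_mul]
    split_ifs with hn
    · congr 1
      rcases Nat.eq_zero_or_pos n with rfl | hpos
      · simp
      · exact coeff_pow_congr (fun i hi => ih i (by omega)) n _ le_rfl
    · rfl

end NCLagrange

end

theorem mainTheorem2 (R : Type*) [CommRing R] :
    (∀ q : Rˣ, ∃ L : (NCLagrange.NSym R)⟦X⟧,
      NCLagrange.FormalHasSum
        (fun n => PowerSeries.C (NCLagrange.S R n) *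
          NCLagrange.qPow (q : R) (NCLagrange.K q) n) L ∧
      NCLagrange.K q = (q : R) • (PowerSeries.X * L)) ∧
    (∀ n : ℕ, PowerSeries.coeff n (NCLagrange.G (1 : Rˣ)) =
      NCLagrange.ch R (NCLagrange.permRep (NCLagrange.PF_stable n))) ∧
    NCLagrange.LagrangeEq (NCLagrange.gPF R) ∧
    ∀ h : NCLagrange.NSymHat R, NCLagrange.LagrangeEq h → h = NCLagrange.gPF R :=
  ⟨NCLagrange.K_functional_equation, NCLagrange.coeff_G_one, NCLagrange.lagrangeEq_gPF,
    fun _ hh => hh.unique NCLagrange.lagrangeEq_gPF⟩
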